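/- Let $k\ge 1$ and $n\ge 0$ be integers, let $M^k$ be a compact smooth ($C^\infty$) manifold with (possibly empty) boundary, and let $x:M\to\mathbb R^{n+1}$ be a smooth immersion with $x(M)\subset \overline{B}$ and $x(\partial M)\subset\partial B$, where $B=\{|x|<1\}$ is the open unit ball centred at the origin. Assume that $x$ is minimal, i.e. its mean curvature vector $\vec H=\frac1k\operatorname{tr}_g\sigma$ vanishes identically, where $g$ is the metric induced by $x$ and $\sigma(X,Y)=(D_XY)^\perp$ is the second fundamental form; and that $M$ has free boundary, i.e. it meets the unit sphere orthogonally: $\nu=x$ along $\partial M$, where $\nu$ is the outward unit conormal of $\partial M$ in $M$. Let $da$ be the area measure of $g$. Then $M$ has finite area, $x$ is integrable, and the mass center of $M$ is at the origin: $$\int_M x\,da=0,\qquad\text{hence}\qquad \frac{1}{|M|}\int_M x\,da=0 \quad (M\neq\emptyset).$$ -/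

import Mathlib

open scoped Manifold ContDiff Topology

noncomputable section

/-- Euclidean space `ℝᵈ` with its standard inner product. -/
abbrev Euc (d : ℕ) : Type := EuclideanSpace ℝ (Fin d)

namespace FreeBoundary

section Coordinates

/-! ### A piece of a submanifold, given by a parametrization

`u` is a parametrization defined (at least) near a point `y` of the closed half-space
`{y | 0 ≤ y 0} = range (𝓡∂ k)` of `ℝᵏ`; derivatives are taken within that half-space, so that they
are one-sided at boundary points. -/

variable {k d : ℕ} [NeZero k]

/-- The coordinate tangent vector `∂ᵢu(y)`. -/
def coordVector (u : Euc k → Euc d) (y : Euc k) (i : Fin k) : Euc d :=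
  fderivWithin ℝ u (Set.range (𝓡∂ k)) y (EuclideanSpace.single i 1)

/-- The second partial derivative `∂ᵢ∂ⱼu(y)`. -/
def coordSecondDeriv (u : Euc k → Euc d) (y : Euc k) (i j : Fin k) : Euc d :=
  fderivWithin ℝ (fun z => fderivWithin ℝ u (Set.range (𝓡∂ k)) z) (Set.range (𝓡∂ k)) y
    (EuclideanSpace.single i 1) (EuclideanSpace.single j 1)

/-- The induced metric `gᵢⱼ = ⟨∂ᵢu, ∂ⱼu⟩`. -/
def inducedMetric (u : Euc k → Euc d) (y : Euc k) : Matrix (Fin k) (Fin k) ℝ :=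
  Matrix.of fun i j => inner ℝ (coordVector u y i) (coordVector u y j)

/-- The tangent space of the piece: the span of the coordinate vectors. -/
def tangentPlane (u : Euc k → Euc d) (y : Euc k) : Submodule ℝ (Euc d) :=
  Submodule.span ℝ (Set.range (coordVector u y))

/-- The (vector-valued) second fundamental form `σ(∂ᵢ, ∂ⱼ) = (D_{∂ᵢ} ∂ⱼu)^⊥ = (∂ᵢ∂ⱼu)^⊥`. -/
def secondFundamentalForm (u : Euc k → Euc d) (y : Euc k) (i j : Fin k) : Euc d :=
  (tangentPlane u y)ᗮ.starProjection (coordSecondDeriv u y i j)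

/-- The mean curvature vector `(1/k) ∑ᵢⱼ gⁱʲ σ(∂ᵢ, ∂ⱼ)`. -/
def meanCurvatureVector (u : Euc k → Euc d) (y : Euc k) : Euc d :=
  (k : ℝ)⁻¹ • ∑ i, ∑ j, (inducedMetric u y)⁻¹ i j • secondFundamentalForm u y i j

/-- The area density `√(det g)`. -/
def areaDensity (u : Euc k → Euc d) (y : Euc k) : ℝ :=
  √(inducedMetric u y).det

end Coordinates

section Immersions

/-! ### Maps from a `k`-dimensional manifold with boundary into `ℝᵈ` -/

variable (k : ℕ) {d : ℕ} [NeZero k] {M : Type*} [TopologicalSpace M]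
  [ChartedSpace (EuclideanHalfSpace k) M]

/-- `x` is a smooth immersion (up to the boundary). -/
structure IsSmoothImmersion (x : M → Euc d) : Prop where
  smooth : ContMDiff (𝓡∂ k) 𝓘(ℝ, Euc d) ∞ x
  injective_mfderiv : ∀ p : M, Function.Injective (mfderiv (𝓡∂ k) 𝓘(ℝ, Euc d) x p)

/-- `x` read in the chart of `M` around `q`: the local parametrization `x ∘ φ_q⁻¹`, meaningful on
`(extChartAt (𝓡∂ k) q).target`. -/
def localParam (x : M → Euc d) (q : M) : Euc k → Euc d :=
  x ∘ (extChartAt (𝓡∂ k) q).symm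

/-- `x` is minimal: its mean curvature vector vanishes everywhere. The mean curvature vector at a
point does not depend on the chart in which it is computed; it is computed in each chart
`φ_q`, at every point of the image of that chart. -/
def IsMinimal (x : M → Euc d) : Prop :=
  ∀ q : M, ∀ y ∈ (extChartAt (𝓡∂ k) q).target, meanCurvatureVector (localParam k x q) y = 0

/-- `ν` is the outward unit conormal of `∂M` in `M` at the boundary point `p`, as a vector of `ℝᵈ`:
it is the image of an outward pointing tangent vector, it has length one, and it is orthogonal
to `∂M`. The tangent space at `p` is identified with `ℝᵏ` by the chart around `p`, which takes
values in `{y | 0 ≤ y 0}` and maps `∂M` to `{y | y 0 = 0}`; so outward pointing vectors are those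
with `v 0 < 0`, and the vectors tangent to `∂M` are those with `w 0 = 0`. -/
def IsOutwardUnitConormal (x : M → Euc d) (p : M) (ν : Euc d) : Prop :=
  (∃ v : Euc k, v 0 < 0 ∧ (mfderiv (𝓡∂ k) 𝓘(ℝ, Euc d) x p : Euc k →L[ℝ] Euc d) v = ν) ∧
  ‖ν‖ = 1 ∧
  ∀ w : Euc k, w 0 = 0 →
    inner ℝ ν ((mfderiv (𝓡∂ k) 𝓘(ℝ, Euc d) x p : Euc k →L[ℝ] Euc d) w) = 0

/-- `x` maps `M` into the closed unit ball and `∂M` into the unit sphere, and it meets the sphere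
orthogonally along `∂M`: the outward unit conormal at a boundary point `p` is `x p`. -/
structure HasFreeBoundaryInUnitBall (x : M → Euc d) : Prop where
  mem_ball : ∀ p : M, x p ∈ Metric.closedBall (0 : Euc d) 1
  mem_sphere : ∀ p ∈ (𝓡∂ k).boundary M, x p ∈ Metric.sphere (0 : Euc d) 1
  conormal : ∀ p ∈ (𝓡∂ k).boundary M, IsOutwardUnitConormal k x p (x p)

variable [MeasurableSpace M]

/-- The area measure of the part of `M` in the domain of the chart `φ_q`: the measure
`√(det g) dy` on the image of the chart, carried over to `M`. -/
def chartArea (x : M → Euc d) (q : M) : MeasureTheory.Measure M :=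
  (((MeasureTheory.volume : MeasureTheory.Measure (Euc k)).restrict
      (extChartAt (𝓡∂ k) q).target).withDensity
    fun y => ENNReal.ofReal (areaDensity (localParam k x q) y)).map (extChartAt (𝓡∂ k) q).symm

/-- The area measure `da` of the metric that `x` induces on `M`: the least measure which dominates
the area measures of all the chart domains. As these agree on overlaps, it is the measure that
equals `√(det g) dy` in every chart. -/
def areaMeasure (x : M → Euc d) : MeasureTheory.Measure M :=
  ⨆ q : M, chartArea k x q

/-- The mass center `(1/|M|) ∫_M x da`. -/
def massCenter (x : M → Euc d) : Euc d :=
  ⨍ p, x p ∂(areaMeasure k x)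

end Immersions

end FreeBoundary

end

/-! Fix a vector `e` and test the mass center against it. The field `Y(x) = 2⟨x, e⟩x - (1 + |x|²)e`
is a conformal Killing field: its derivative is `2⟨x, e⟩ Id` plus a skew part. Its trace over any
`k`-dimensional tangent plane is therefore `2k⟨x, e⟩`. On a minimal submanifold the normal part of
`Y` contributes nothing to this trace, so the tangential part `X` of `Y` satisfies `div X = 2k⟨x,
e⟩`. On the unit sphere `Y` is orthogonal to `x`, which is the conormal by the free boundary
condition; hence `X` is tangent to `∂M`, the divergence theorem has no boundary term, and `∫ ⟨x, e⟩
da = 0`.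

The formula for `div X` is `divergence_conformalField`, obtained from `divergence_tangentialCoeff`
and `trace_conformalField`; tangency at the boundary is `conformalCoeff_apply_zero`. Integration is
done in charts on `ρX`, with `ρ` a cut-off function: `setIntegral_halfSpace_divergence_eq_zero`
gives `∫ (dρ(X) + 2k⟨x, e⟩ρ) da = 0`, provided that the integrand and `da` do not depend on the
chart. Summing over a smooth partition of unity removes the terms `dρ(X)`. -/

noncomputable section

namespace FreeBoundary

/-! ### Derivatives of determinants and inverse matrices -/

section Jacobi

variable {E : Type*} [NormedAddCommGroup E] [NormedSpace ℝ E] {ι : Type*} [Fintype ι]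
  [DecidableEq ι]

/-- Jacobi's formula for the derivative of a determinant. -/
theorem hasFDerivAt_det {A : E → Matrix ι ι ℝ} {A' : ι → ι → E →L[ℝ] ℝ} {y : E}
    (hA : ∀ i j, HasFDerivAt (fun z => A z i j) (A' i j) y) :
    HasFDerivAt (fun z => (A z).det) (∑ i, ∑ j, (A y).adjugate j i • A' i j) y := by
  -- The determinant is multilinear in the rows, so its derivative replaces one row at a time;
  -- Cramer's rule then yields the cofactors.
  let D : ContinuousMultilinearMap ℝ (fun _ : ι => ι → ℝ) ℝ :=
    { Matrix.detRowAlternating.toMultilinearMap with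
      cont := Continuous.matrix_det (A := fun m : Matrix ι ι ℝ => m) continuous_id }
  have hD : ∀ m : ι → ι → ℝ, D m = Matrix.det (m : Matrix ι ι ℝ) := fun m => rfl
  have h1 : HasFDerivAt (fun z => (fun i j => A z i j : ι → ι → ℝ))
      (ContinuousLinearMap.pi fun i => ContinuousLinearMap.pi fun j => A' i j) y :=
    hasFDerivAt_pi.2 fun i => hasFDerivAt_pi.2 fun j => hA i j
  refine ((D.hasFDerivAt _).comp y h1).congr_fderiv ?_
  ext v
  simp only [ContinuousLinearMap.comp_apply, ContinuousMultilinearMap.linearDeriv_apply,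
    sum_apply, smul_apply, hD, smul_eq_mul]
  refine Finset.sum_congr rfl fun i _ => ?_
  have h2 : (Matrix.updateRow (A y) i fun j => A' i j v).det
      = ∑ j, (A y).adjugate j i * A' i j v := by
    rw [← Matrix.cramer_transpose_apply, Matrix.cramer_eq_adjugate_mulVec,
      ← Matrix.adjugate_transpose]
    rfl
  exact h2

theorem contDiffWithinAt_det {A : E → Matrix ι ι ℝ} {s : Set E} {y : E} {m : ℕ∞ω}
    (hA : ∀ i j, ContDiffWithinAt ℝ m (fun z => A z i j) s y) :
    ContDiffWithinAt ℝ m (fun z => (A z).det) s y := by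
  simp only [Matrix.det_apply']
  exact ContDiffWithinAt.sum fun σ _ =>
    contDiffWithinAt_const.mul (contDiffWithinAt_prod fun i _ => hA _ _)

theorem contDiffWithinAt_inv_apply {A : E → Matrix ι ι ℝ} {s : Set E} {y : E} {m : ℕ∞ω}
    (hA : ∀ i j, ContDiffWithinAt ℝ m (fun z => A z i j) s y) (hdet : (A y).det ≠ 0) (i j : ι) :
    ContDiffWithinAt ℝ m (fun z => (A z)⁻¹ i j) s y := by
  simp only [Matrix.inv_def, Ring.inverse_eq_inv', Matrix.smul_apply, smul_eq_mul,
    Matrix.adjugate_apply]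
  refine ((contDiffWithinAt_det hA).inv hdet).mul (contDiffWithinAt_det fun a b => ?_)
  rcases eq_or_ne a j with rfl | h
  · simpa using contDiffWithinAt_const
  · simpa [Matrix.updateRow_ne h] using hA a b

end Jacobi

/-! ### Gram matrices and orthogonal projection in coordinates -/

section LinearAlgebra

variable {k d : ℕ}

/-- The `i`-th standard basis vector. -/
abbrev stdVec (i : Fin k) : Euc k := EuclideanSpace.single i 1

theorem sum_smul_stdVec (v : Euc k) : v = ∑ i, v i • stdVec i := by
  ext j
  simp [Finset.sum_apply, Pi.single_apply]

theorem map_eq_sum {F : Type*} [AddCommGroup F] [Module ℝ F] [TopologicalSpace F]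
    (L : Euc k →L[ℝ] F) (v : Euc k) : L v = ∑ i, v i • L (stdVec i) := by
  conv_lhs => rw [sum_smul_stdVec v]
  simp

/-- The Gram matrix of a linear map in the standard basis. -/
def gramMatrix (L : Euc k →L[ℝ] Euc d) : Matrix (Fin k) (Fin k) ℝ :=
  Matrix.gram ℝ fun i => L (stdVec i)

theorem gramMatrix_apply (L : Euc k →L[ℝ] Euc d) (i j : Fin k) :
    gramMatrix L i j = inner ℝ (L (stdVec i)) (L (stdVec j)) := rfl

theorem gramMatrix_symm (L : Euc k →L[ℝ] Euc d) (i j : Fin k) :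
    gramMatrix L i j = gramMatrix L j i := by
  rw [gramMatrix_apply, gramMatrix_apply, real_inner_comm]

theorem gramMatrix_inv_symm (L : Euc k →L[ℝ] Euc d) (i j : Fin k) :
    (gramMatrix L)⁻¹ i j = (gramMatrix L)⁻¹ j i := by
  have h : (gramMatrix L).transpose = gramMatrix L := by
    ext i j; exact gramMatrix_symm L j i
  conv_lhs => rw [← h, ← Matrix.transpose_nonsing_inv]
  rfl

theorem gramMatrix_det_nonneg (L : Euc k →L[ℝ] Euc d) : 0 ≤ (gramMatrix L).det :=
  (Matrix.posSemidef_gram ℝ _).det_nonneg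

theorem gramMatrix_det_pos {L : Euc k →L[ℝ] Euc d} (hL : Function.Injective L) :
    0 < (gramMatrix L).det := by
  refine (Matrix.posDef_gram_of_linearIndependent ?_).det_pos
  have h := (EuclideanSpace.basisFun (Fin k) ℝ).toBasis.linearIndependent.map'
    (L : Euc k →ₗ[ℝ] Euc d) (LinearMap.ker_eq_bot.2 hL)
  have he : (fun i => L (stdVec i)) =
      (L : Euc k →ₗ[ℝ] Euc d) ∘ (EuclideanSpace.basisFun (Fin k) ℝ).toBasis := by
    ext i : 1
    simp
  rw [he]
  exact h

/-- The Gram matrix of `L ∘ A` is `Aᵀ G A`, so that the area density gets multiplied by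
`|det A|`. -/
theorem sqrt_det_gramMatrix_comp (L : Euc k →L[ℝ] Euc d) (A : Euc k →L[ℝ] Euc k) :
    √(gramMatrix (L.comp A)).det = |A.det| * √(gramMatrix L).det := by
  let b := (EuclideanSpace.basisFun (Fin k) ℝ).toBasis
  let P := LinearMap.toMatrix b b (A : Euc k →ₗ[ℝ] Euc k)
  have hP : ∀ i j, P i j = A (stdVec j) i := by
    intro i j
    simp [P, b, LinearMap.toMatrix_apply]
  have h : gramMatrix (L.comp A) = P.transpose * gramMatrix L * P := by
    ext i j
    simp only [gramMatrix_apply, ContinuousLinearMap.comp_apply, Matrix.mul_apply,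
      Matrix.transpose_apply, hP]
    rw [map_eq_sum L (A (stdVec i)), map_eq_sum L (A (stdVec j)), sum_inner]
    simp only [inner_sum, real_inner_smul_left, real_inner_smul_right, Finset.sum_mul]
    rw [Finset.sum_comm]
    exact Finset.sum_congr rfl fun a _ => Finset.sum_congr rfl fun c _ => by ring
  have hd : P.det = A.det := LinearMap.det_toMatrix b _
  rw [h, Matrix.det_mul, Matrix.det_mul, Matrix.det_transpose, hd, mul_comm, ← mul_assoc,
    Real.sqrt_mul (mul_self_nonneg _), Real.sqrt_mul_self_eq_abs]

/-- The vector `w` such that `L w` is the orthogonal projection of `Y` to the range of `L`, for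
an injective linear map `L`. -/
def tangentialCoeff (L : Euc k →L[ℝ] Euc d) (Y : Euc d) : Euc k :=
  WithLp.toLp 2 fun i => ∑ j, (gramMatrix L)⁻¹ i j * inner ℝ (L (stdVec j)) Y

theorem tangentialCoeff_apply (L : Euc k →L[ℝ] Euc d) (Y : Euc d) (i : Fin k) :
    tangentialCoeff L Y i = ∑ j, (gramMatrix L)⁻¹ i j * inner ℝ (L (stdVec j)) Y := rfl

variable {L : Euc k →L[ℝ] Euc d}

/-- These are the normal equations of the projection. Differentiating them later avoids
differentiating the inverse matrix. -/
theorem gramMatrix_mul_tangentialCoeff (hL : (gramMatrix L).det ≠ 0) (Y : Euc d) (j : Fin k) :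
    ∑ i, gramMatrix L j i * tangentialCoeff L Y i = inner ℝ (L (stdVec j)) Y := by
  have h : (gramMatrix L).mulVec ((gramMatrix L)⁻¹.mulVec fun j => inner ℝ (L (stdVec j)) Y)
      = fun j => inner ℝ (L (stdVec j)) Y := by
    rw [Matrix.mulVec_mulVec, Matrix.mul_nonsing_inv _ hL.isUnit,
      Matrix.one_mulVec]
  exact congrFun h j

theorem inner_tangentialCoeff (hL : Function.Injective L) (Y : Euc d) (v : Euc k) :
    inner ℝ (L (tangentialCoeff L Y)) (L v) = inner ℝ Y (L v) := by
  have h : ∀ j, inner ℝ (L (tangentialCoeff L Y)) (L (stdVec j)) = inner ℝ Y (L (stdVec j)) := by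
    intro j
    rw [map_eq_sum L (tangentialCoeff L Y), real_inner_comm, inner_sum, real_inner_comm,
      ← gramMatrix_mul_tangentialCoeff (gramMatrix_det_pos hL).ne' Y j]
    refine Finset.sum_congr rfl fun i _ => ?_
    rw [real_inner_smul_right, gramMatrix_apply, mul_comm]
  rw [map_eq_sum L v, inner_sum, inner_sum]
  simp only [real_inner_smul_right, h]

theorem eq_tangentialCoeff (hL : Function.Injective L) {Y : Euc d} {w : Euc k}
    (hw : ∀ v, inner ℝ (L w) (L v) = inner ℝ Y (L v)) : w = tangentialCoeff L Y := by
  have h : inner ℝ (L (w - tangentialCoeff L Y)) (L (w - tangentialCoeff L Y)) = 0 := by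
    conv_lhs => arg 2; rw [map_sub]
    rw [inner_sub_left, hw, inner_tangentialCoeff hL, sub_self]
  have h2 := inner_self_eq_zero.1 h
  exact sub_eq_zero.1 (hL (h2.trans (map_zero L).symm))

/-- The projection depends only on the range of `L`, so uniqueness in `eq_tangentialCoeff` forces
its coordinates to transform as a vector. -/
theorem map_tangentialCoeff_comp (hL : Function.Injective L) {A B : Euc k →L[ℝ] Euc k}
    (hBA : ∀ v, B (A v) = v) (hAB : ∀ v, A (B v) = v) (Y : Euc d) :
    A (tangentialCoeff (L.comp A) Y) = tangentialCoeff L Y := by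
  have hLA : Function.Injective (L.comp A) := hL.comp (Function.LeftInverse.injective hBA)
  refine eq_tangentialCoeff hL fun v => ?_
  have := inner_tangentialCoeff hLA Y (B v)
  simpa [hAB] using this

end LinearAlgebra

/-! ### Divergence of the tangential part of an ambient field -/

section Divergence

variable {k d : ℕ}

theorem contDiffWithinAt_gramMatrix {L : Euc k → Euc k →L[ℝ] Euc d} {s : Set (Euc k)} {y : Euc k}
    {m : ℕ∞ω} (hL : ContDiffWithinAt ℝ m L s y) (i j : Fin k) :
    ContDiffWithinAt ℝ m (fun z => gramMatrix (L z) i j) s y :=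
  (hL.clm_apply contDiffWithinAt_const).inner ℝ (hL.clm_apply contDiffWithinAt_const)

theorem contDiffWithinAt_tangentialCoeff {L : Euc k → Euc k →L[ℝ] Euc d} {Y : Euc k → Euc d}
    {s : Set (Euc k)} {y : Euc k} {m : ℕ∞ω} (hL : ContDiffWithinAt ℝ m L s y)
    (hinj : Function.Injective (L y)) (hY : ContDiffWithinAt ℝ m Y s y) :
    ContDiffWithinAt ℝ m (fun z => tangentialCoeff (L z) (Y z)) s y := by
  refine contDiffWithinAt_euclidean.2 fun i => ?_
  simp only [tangentialCoeff_apply]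
  exact ContDiffWithinAt.sum fun j _ =>
    (contDiffWithinAt_inv_apply (contDiffWithinAt_gramMatrix hL)
      (gramMatrix_det_pos hinj).ne' i j).mul ((hL.clm_apply contDiffWithinAt_const).inner ℝ hY)

theorem contDiffWithinAt_sqrt_det {L : Euc k → Euc k →L[ℝ] Euc d}
    {s : Set (Euc k)} {y : Euc k} {m : ℕ∞ω} (hL : ContDiffWithinAt ℝ m L s y)
    (hinj : Function.Injective (L y)) :
    ContDiffWithinAt ℝ m (fun z => √(gramMatrix (L z)).det) s y :=
  (contDiffWithinAt_det (contDiffWithinAt_gramMatrix hL)).sqrt (gramMatrix_det_pos hinj).ne'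

/-- The divergence, with respect to the density `√det G`, of the tangential part of a vector field
`Y` along a parametrized submanifold with `DL` its second derivative and vanishing
mean curvature. -/
theorem divergence_tangentialCoeff {L : Euc k → Euc k →L[ℝ] Euc d} {Y : Euc k → Euc d} {y : Euc k}
    {DL : Euc k →L[ℝ] Euc k →L[ℝ] Euc d} {DY : Euc k →L[ℝ] Euc d}
    (hcont : ContDiffAt ℝ 1 L y) (hL : HasFDerivAt L DL y)
    (hsymm : ∀ v w, DL v w = DL w v) (hinj : Function.Injective (L y))
    (hmin : ∀ N : Euc d, (∀ v, inner ℝ N (L y v) = 0) →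
      ∑ i, ∑ j, (gramMatrix (L y))⁻¹ i j * inner ℝ N (DL (stdVec i) (stdVec j)) = 0)
    (hYc : ContDiffAt ℝ 1 Y y) (hY : HasFDerivAt Y DY y) :
    ∃ (J' : Euc k →L[ℝ] ℝ) (X' : Euc k →L[ℝ] Euc k),
      HasFDerivAt (fun z => √(gramMatrix (L z)).det) J' y ∧
      HasFDerivAt (fun z => tangentialCoeff (L z) (Y z)) X' y ∧
      J' (tangentialCoeff (L y) (Y y)) + √(gramMatrix (L y)).det * ∑ i, X' (stdVec i) i =
        √(gramMatrix (L y)).det *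
          ∑ i, ∑ j, (gramMatrix (L y))⁻¹ i j * inner ℝ (L y (stdVec j)) (DY (stdVec i)) := by
  have hdet : (gramMatrix (L y)).det ≠ 0 := (gramMatrix_det_pos hinj).ne'
  have hτ : ∀ i, HasFDerivAt (fun z => L z (stdVec i)) (DL.flip (stdVec i)) y := fun i =>
    ((ContinuousLinearMap.apply ℝ (Euc d) (stdVec i)).hasFDerivAt.comp y hL).congr_fderiv
      (by ext v; simp)
  have hG := fun i j => (hτ i).inner ℝ (hτ j)
  have hb := fun j => (hτ j).inner ℝ hY
  have hJ := (hasFDerivAt_det (A := fun z => gramMatrix (L z)) hG).sqrt hdet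
  have hX : HasFDerivAt (fun z => tangentialCoeff (L z) (Y z))
      (fderiv ℝ (fun z => tangentialCoeff (L z) (Y z)) y) y :=
    ((contDiffWithinAt_univ.1 (contDiffWithinAt_tangentialCoeff (contDiffWithinAt_univ.2 hcont)
      hinj (contDiffWithinAt_univ.2 hYc))).differentiableAt one_ne_zero).hasFDerivAt
  set X' := fderiv ℝ (fun z => tangentialCoeff (L z) (Y z)) y with hX'
  have hXi : ∀ i, HasFDerivAt (fun z => tangentialCoeff (L z) (Y z) i)
      ((EuclideanSpace.proj i : Euc k →L[ℝ] ℝ).comp X') y := fun i =>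
    (EuclideanSpace.proj i : Euc k →L[ℝ] ℝ).hasFDerivAt.comp y hX
  set X := tangentialCoeff (L y) (Y y) with hXdef
  set Q := (gramMatrix (L y))⁻¹ with hQ
  -- differentiate the linear system `G X = b`
  have hsys : ∀ j v, ∑ i, gramMatrix (L y) j i * X' v i =
      inner ℝ (DL v (stdVec j)) (Y y - L y X) + inner ℝ (L y (stdVec j)) (DY v)
        - inner ℝ (L y (stdVec j)) (DL v X) := by
    intro j v
    have hev : ∀ᶠ z in 𝓝 y, (gramMatrix (L z)).det ≠ 0 :=
      (hasFDerivAt_det (A := fun z => gramMatrix (L z)) hG).continuousAt.eventually_ne hdet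
    have h1 := HasFDerivAt.fun_sum (u := Finset.univ) fun i _ => (hG j i).mul (hXi i)
    have h2 := h1.unique ((hb j).congr_of_eventuallyEq
      (hev.mono fun z hz => gramMatrix_mul_tangentialCoeff hz (Y z) j))
    have h3 := DFunLike.congr_fun h2 v
    simp only [sum_apply, add_apply, smul_apply, ContinuousLinearMap.comp_apply,
      ContinuousLinearMap.prod_apply, fderivInnerCLM_apply, ContinuousLinearMap.flip_apply,
      smul_eq_mul, PiLp.proj_apply, Finset.sum_add_distrib, ← hXdef] at h3
    have h4 : ∑ l, X l * (inner ℝ (L y (stdVec j)) (DL v (stdVec l)) +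
        inner ℝ (DL v (stdVec j)) (L y (stdVec l))) =
        inner ℝ (L y (stdVec j)) (DL v X) + inner ℝ (DL v (stdVec j)) (L y X) := by
      rw [map_eq_sum (DL v) X, map_eq_sum (L y) X, inner_sum, inner_sum,
        ← Finset.sum_add_distrib]
      simp only [real_inner_smul_right, mul_add]
    simp only [mul_add, Finset.sum_add_distrib] at h3 h4
    rw [inner_sub_right]
    simp only [gramMatrix_apply]
    linarith
  -- Multiplying the differentiated system by `G⁻¹` isolates the derivative of `X`.
  have hdiv : ∀ v i, X' v i = ∑ j, Q i j * (inner ℝ (DL v (stdVec j)) (Y y - L y X)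
      + inner ℝ (L y (stdVec j)) (DY v) - inner ℝ (L y (stdVec j)) (DL v X)) := by
    intro v i
    have h : Q.mulVec ((gramMatrix (L y)).mulVec (fun i => X' v i)) = fun i => X' v i := by
      rw [Matrix.mulVec_mulVec, Matrix.nonsing_inv_mul _ hdet.isUnit, Matrix.one_mulVec]
    rw [← congrFun h i]
    simp only [← hsys]
    rfl
  have hN : ∀ v, inner ℝ (Y y - L y X) (L y v) = 0 := fun v => by
    rw [inner_sub_left, inner_tangentialCoeff hinj, sub_self]
  refine ⟨_, X', hJ, hX, ?_⟩
  have hadj : ∀ i j, (gramMatrix (L y)).adjugate i j = (gramMatrix (L y)).det * Q i j := by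
    intro i j
    rw [hQ, Matrix.inv_def, Ring.inverse_eq_inv', Matrix.smul_apply, smul_eq_mul,
      mul_inv_cancel_left₀ hdet]
  have hQs : ∀ i j, Q i j = Q j i := gramMatrix_inv_symm _
  -- By symmetry of `Q` the two halves of the derivative of `G` contribute equally; this factor 2
  -- cancels the 1/2 from the square root.
  have hJX : ∀ v, (∑ i, ∑ j, Q j i * (inner ℝ (L y (stdVec i)) (DL v (stdVec j)) +
      inner ℝ (DL v (stdVec i)) (L y (stdVec j)))) =
      2 * ∑ i, ∑ j, Q i j * inner ℝ (L y (stdVec j)) (DL v (stdVec i)) := by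
    intro v
    simp only [mul_add, Finset.sum_add_distrib, two_mul]
    congr 1
    · exact Finset.sum_comm
    · refine Finset.sum_congr rfl fun i _ => Finset.sum_congr rfl fun j _ => ?_
      rw [hQs, real_inner_comm]
  have hmin' := hmin _ hN
  simp only [hdiv, mul_sub, mul_add, Finset.sum_sub_distrib, Finset.sum_add_distrib]
  -- Minimality enters here: `Y - L X` is normal.
  have e1 : ∑ i, ∑ j, Q i j * inner ℝ (DL (stdVec i) (stdVec j)) (Y y - L y X) = 0 := by
    rw [← hmin']
    refine Finset.sum_congr rfl fun i _ => Finset.sum_congr rfl fun j _ => ?_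
    rw [real_inner_comm]
  -- Symmetry of second derivatives turns this Christoffel term into the one that the derivative of
  -- the density along `X` cancels.
  have e2 : ∑ i, ∑ j, Q i j * inner ℝ (L y (stdVec j)) (DL (stdVec i) X) =
      ∑ i, ∑ j, Q i j * inner ℝ (L y (stdVec j)) (DL X (stdVec i)) := by
    refine Finset.sum_congr rfl fun i _ => Finset.sum_congr rfl fun j _ => ?_
    rw [hsymm]
  rw [e1, e2]
  simp only [sum_apply, smul_apply, ContinuousLinearMap.comp_apply,
    ContinuousLinearMap.prod_apply, fderivInnerCLM_apply, ContinuousLinearMap.flip_apply,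
    smul_eq_mul, hadj, mul_assoc, ← Finset.mul_sum, hJX]
  have hs := Real.mul_self_sqrt (gramMatrix_det_nonneg (L y))
  have hs0 : √(gramMatrix (L y)).det ≠ 0 := (Real.sqrt_pos.2 (gramMatrix_det_pos hinj)).ne'
  generalize √(gramMatrix (L y)).det = r at hs hs0 ⊢
  rw [← hs]
  field_simp
  ring

end Divergence

/-! ### The divergence theorem on the half-space -/

open MeasureTheory Set

/-- The divergence theorem on the half-space, for a compactly supported vector field which is
tangent to the boundary. -/
theorem setIntegral_halfSpace_divergence_eq_zero {k : ℕ} [NeZero k] {F : Euc k → Euc k}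
    {F' : Euc k → Euc k →L[ℝ] Euc k} {D : Euc k → ℝ} {K : Set (Euc k)} (hK : IsCompact K)
    (hF : ContinuousOn F {y | 0 ≤ y 0}) (hF0 : ∀ y ∉ K, F y = 0)
    (htan : ∀ y : Euc k, y 0 = 0 → F y 0 = 0)
    (hF' : ∀ y : Euc k, 0 < y 0 → HasFDerivAt F (F' y) y)
    (hD : ContinuousOn D {y | 0 ≤ y 0}) (hD0 : ∀ y ∉ K, D y = 0)
    (hDF : ∀ y : Euc k, 0 < y 0 → D y = ∑ i, F' y (stdVec i) i) :
    ∫ y in {y : Euc k | 0 ≤ y 0}, D y = 0 := by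
  obtain ⟨m, rfl⟩ : ∃ m, k = m + 1 := Nat.exists_eq_succ_of_ne_zero (NeZero.ne k)
  obtain ⟨R, hR0, hR⟩ : ∃ R : ℝ, 0 < R ∧ ∀ y ∈ K, ∀ i, |y i| < R := by
    obtain ⟨R, hR0, hR⟩ := hK.isBounded.exists_pos_norm_lt
    exact ⟨R, hR0, fun y hy i => (PiLp.norm_apply_le y i).trans_lt (hR y hy)⟩
  let e : (Fin (m + 1) → ℝ) ≃L[ℝ] Euc (m + 1) := (EuclideanSpace.equiv (Fin (m + 1)) ℝ).symm
  have he : ∀ z i, e z i = z i := fun z i => rfl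
  have hemb : MeasurableEmbedding (WithLp.toLp 2 : (Fin (m + 1) → ℝ) → Euc (m + 1)) :=
    e.toHomeomorph.measurableEmbedding
  have hvol := (PiLp.volume_preserving_toLp (Fin (m + 1))).setIntegral_preimage_emb hemb D
    {y | 0 ≤ y 0}
  rw [← hvol]
  -- The box has one face on the hyperplane `y 0 = 0`; all its other faces avoid `K`, by the choice
  -- of `R`.
  let a : Fin (m + 1) → ℝ := Function.update (fun _ => -R) 0 0
  let b : Fin (m + 1) → ℝ := fun _ => R
  have ha0 : a 0 = 0 := by simp [a]
  have ha : ∀ i ≠ 0, a i = -R := fun i hi => by simp [a, hi]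
  have hle : a ≤ b := by
    intro i
    rcases eq_or_ne i 0 with rfl | hi
    · rw [ha0]; exact hR0.le
    · rw [ha i hi]; show -R ≤ R; linarith
  have hsub : Icc a b ⊆ {z | 0 ≤ z 0} := fun z hz => by
    have := hz.1 0
    rwa [ha0] at this
  have hIcc : ∫ z in WithLp.toLp 2 ⁻¹' {y : Euc (m + 1) | 0 ≤ y 0}, D (WithLp.toLp 2 z) =
      ∫ z in Icc a b, D (e z) := by
    have hmH : MeasurableSet {z : Fin (m + 1) → ℝ | 0 ≤ z 0} :=
      measurableSet_le measurable_const (measurable_pi_apply 0)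
    refine setIntegral_eq_of_subset_of_forall_sdiff_eq_zero (f := fun z => D (e z)) hmH hsub ?_
    rintro z ⟨hz, hzn⟩
    refine hD0 _ fun hzK => hzn ⟨fun i => ?_, fun i => ((abs_lt.1 (hR _ hzK i)).2).le⟩
    rcases eq_or_ne i 0 with rfl | hi
    · rw [ha0]; exact hz
    · rw [ha i hi]; exact ((abs_lt.1 (hR _ hzK i)).1).le
  rw [hIcc]
  let f' : Fin (m + 1) → (Fin (m + 1) → ℝ) → (Fin (m + 1) → ℝ) →L[ℝ] ℝ := fun i z =>
    ((EuclideanSpace.proj i : Euc (m + 1) →L[ℝ] ℝ).comp (F' (e z))).comp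
      (e : (Fin (m + 1) → ℝ) →L[ℝ] Euc (m + 1))
  have hsum : ∀ z : Fin (m + 1) → ℝ, 0 < z 0 → D (e z) = ∑ i, f' i z (Pi.single i 1) := by
    intro z hz
    rw [hDF (e z) hz]
    rfl
  have hpi : ∀ z ∈ (univ.pi fun i => Ioo (a i) (b i)), 0 < z 0 := fun z hz => by
    have := (hz 0 trivial).1
    rwa [ha0] at this
  have hmeas : MeasurableSet (univ.pi fun i => Ioo (a i) (b i)) :=
    MeasurableSet.univ_pi fun i => measurableSet_Ioo
  have hae : (univ.pi fun i => Ioo (a i) (b i)) =ᵐ[volume] Icc a b :=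
    Measure.univ_pi_Ioo_ae_eq_Icc
  have hDe : IntegrableOn (fun z => D (e z)) (Icc a b) := by
    refine ContinuousOn.integrableOn_compact isCompact_Icc ?_
    exact hD.comp e.continuous.continuousOn hsub
  have hdiv := integral_divergence_of_hasFDerivAt_off_countable' a b hle
    (fun i z => F (e z) i) f' ∅ countable_empty
    (fun i => ((EuclideanSpace.proj i : Euc (m + 1) →L[ℝ] ℝ).continuous.comp_continuousOn
      (hF.comp e.continuous.continuousOn hsub)))
    (fun z hz i => (EuclideanSpace.proj i : Euc (m + 1) →L[ℝ] ℝ).hasFDerivAt.comp z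
      ((hF' (e z) (hpi z hz.1)).comp z e.hasFDerivAt))
    ((((hDe.congr_set_ae hae).congr_fun (fun z hz => hsum z (hpi z hz)) hmeas)).congr_set_ae
      hae.symm)
  rw [← setIntegral_congr_set hae] at hdiv ⊢
  rw [setIntegral_congr_fun hmeas fun z hz => hsum z (hpi z hz), hdiv]
  have hout : ∀ (z : Fin (m + 1) → ℝ) i, R ≤ |z i| → F (e z) i = 0 := by
    intro z i hz
    rw [hF0 (e z) fun h => (hR _ h i).not_ge hz]
    rfl
  refine Finset.sum_eq_zero fun i _ => ?_
  have h1 : ∀ x : Fin m → ℝ, F (e (i.insertNth (b i) x)) i = 0 := fun x => by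
    refine hout _ _ ?_
    rw [Fin.insertNth_apply_same]
    exact le_abs_self _
  have h2 : ∀ x : Fin m → ℝ, F (e (i.insertNth (a i) x)) i = 0 := fun x => by
    -- The face on the boundary hyperplane is the only one where tangency is needed.
    rcases eq_or_ne i 0 with rfl | hi
    · refine htan _ ?_
      rw [he, Fin.insertNth_apply_same, ha0]
    · refine hout _ _ ?_
      rw [Fin.insertNth_apply_same, ha i hi, abs_neg]
      exact le_abs_self _
  simp only [h1, h2, integral_zero, sub_self]

/-! ### The conformal field along a minimal piece -/

section LocalComputation

variable {k d : ℕ}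

/-- The conformal vector field `2⟨x, e⟩ x - (1 + |x|²) e`, which is tangent to the unit sphere. -/
def conformalField (e x : Euc d) : Euc d := (2 * inner ℝ x e) • x - (1 + ‖x‖ ^ 2) • e

theorem inner_conformalField_self (e : Euc d) {x : Euc d} (hx : ‖x‖ = 1) :
    inner ℝ (conformalField e x) x = 0 := by
  rw [conformalField, inner_sub_left, real_inner_smul_left, real_inner_smul_left,
    real_inner_self_eq_norm_sq, hx, real_inner_comm e x]
  ring

theorem contDiff_conformalField (e : Euc d) {m : ℕ∞ω} : ContDiff ℝ m (conformalField e) :=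
  ((contDiff_const.mul (contDiff_id.inner ℝ contDiff_const)).smul contDiff_id).sub
    ((contDiff_const.add (contDiff_id.norm_sq ℝ)).smul contDiff_const)

/-- The middle term is a multiple of the identity applied to `L v`, and the outer two form a skew
map of `L v`: this is the conformal Killing property. -/
theorem hasFDerivAt_conformalField_comp (e : Euc d) {u : Euc k → Euc d} {y : Euc k}
    {L : Euc k →L[ℝ] Euc d} (hu : HasFDerivAt u L y) :
    ∃ DY : Euc k →L[ℝ] Euc d, HasFDerivAt (fun z => conformalField e (u z)) DY y ∧
      ∀ v, DY v = (2 * inner ℝ (L v) e) • u y + (2 * inner ℝ (u y) e) • L v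
        - (2 * inner ℝ (u y) (L v)) • e := by
  have h1 := ((hu.inner ℝ (hasFDerivAt_const e y)).const_mul 2).smul hu
  have h2 := ((hu.norm_sq.const_add 1)).smul (hasFDerivAt_const e y)
  refine ⟨_, h1.sub h2, fun v => ?_⟩
  simp [fderivInnerCLM_apply, add_comm]

/-- The skew part has no trace against the symmetric matrix `G⁻¹` (`hcross`), and `tr(G⁻¹G) = k`
gives the rest. -/
theorem trace_conformalField {L : Euc k →L[ℝ] Euc d} (hL : Function.Injective L) (e x : Euc d)
    {DY : Euc k → Euc d} (hDY : ∀ v, DY v = (2 * inner ℝ (L v) e) • x + (2 * inner ℝ x e) • L v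
        - (2 * inner ℝ x (L v)) • e) :
    ∑ i, ∑ j, (gramMatrix L)⁻¹ i j * inner ℝ (L (stdVec j)) (DY (stdVec i)) =
      2 * k * inner ℝ x e := by
  set Q := (gramMatrix L)⁻¹ with hQ
  have htr : ∑ i, ∑ j, Q i j * inner ℝ (L (stdVec j)) (L (stdVec i)) = k := by
    have h : (Q * gramMatrix L).trace = k := by
      rw [hQ, Matrix.nonsing_inv_mul _ (gramMatrix_det_pos hL).ne'.isUnit, Matrix.trace_one,
        Fintype.card_fin]
    rw [← h]
    rfl
  have hcross : ∑ i, ∑ j, Q i j * (inner ℝ x (L (stdVec i)) * inner ℝ (L (stdVec j)) e) =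
      ∑ i, ∑ j, Q i j * (inner ℝ (L (stdVec i)) e * inner ℝ (L (stdVec j)) x) := by
    rw [Finset.sum_comm]
    refine Finset.sum_congr rfl fun i _ => Finset.sum_congr rfl fun j _ => ?_
    rw [hQ, gramMatrix_inv_symm, real_inner_comm x]
    ring
  have hterm : ∀ i j, Q i j * inner ℝ (L (stdVec j)) (DY (stdVec i)) =
      2 * (Q i j * (inner ℝ (L (stdVec i)) e * inner ℝ (L (stdVec j)) x)) +
      2 * inner ℝ x e * (Q i j * inner ℝ (L (stdVec j)) (L (stdVec i))) -
      2 * (Q i j * (inner ℝ x (L (stdVec i)) * inner ℝ (L (stdVec j)) e)) := by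
    intro i j
    rw [hDY, inner_sub_right, inner_add_right, real_inner_smul_right, real_inner_smul_right,
      real_inner_smul_right]
    ring
  simp only [hterm, Finset.sum_sub_distrib, Finset.sum_add_distrib, ← Finset.mul_sum, htr, hcross]
  ring

variable [NeZero k]

theorem areaDensity_eq (u : Euc k → Euc d) (y : Euc k) :
    areaDensity u y = √(gramMatrix (fderivWithin ℝ u (range (𝓡∂ k)) y)).det := rfl

/-- The normal projection is self-adjoint and fixes `N`, so it can be dropped from the second
fundamental form when pairing with `N`. -/
theorem sum_inner_secondDeriv_eq_zero {u : Euc k → Euc d} {y : Euc k}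
    (h : meanCurvatureVector u y = 0) {N : Euc d}
    (hN : ∀ v, inner ℝ N (fderivWithin ℝ u (range (𝓡∂ k)) y v) = 0) :
    ∑ i, ∑ j, (gramMatrix (fderivWithin ℝ u (range (𝓡∂ k)) y))⁻¹ i j *
      inner ℝ N (coordSecondDeriv u y i j) = 0 := by
  have hNm : N ∈ (tangentPlane u y)ᗮ := by
    rw [Submodule.mem_orthogonal']
    intro w hw
    refine Submodule.span_induction (p := fun w _ => inner ℝ N w = 0) ?_ (by simp) ?_ ?_ hw
    · rintro _ ⟨i, rfl⟩
      exact hN _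
    · intro a b _ _ ha hb
      rw [inner_add_right, ha, hb, add_zero]
    · intro c a _ ha
      rw [inner_smul_right, ha, mul_zero]
  have h1 : ∀ w, inner ℝ N ((tangentPlane u y)ᗮ.starProjection w) = inner ℝ N w := by
    intro w
    rw [← Submodule.inner_starProjection_left_eq_right,
      Submodule.starProjection_eq_self_iff.2 hNm]
  have hk : (k : ℝ)⁻¹ ≠ 0 := inv_ne_zero (Nat.cast_ne_zero.2 (NeZero.ne k))
  have h2 := (smul_eq_zero.1 h).resolve_left hk
  have h3 := congrArg (fun w => inner ℝ N w) h2
  simp only [inner_sum, inner_smul_right, secondFundamentalForm, h1, inner_zero_right] at h3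
  exact h3

variable {u : Euc k → Euc d} {T : Set (Euc k)}

theorem range_mem_nhds {y : Euc k} (hy : 0 < y 0) : range (𝓡∂ k) ∈ 𝓝 y := by
  rw [← mem_interior_iff_mem_nhds, interior_range_modelWithCornersEuclideanHalfSpace]
  exact hy

/-- The tangential part of the conformal field along `u`, in the coordinates of `u`. -/
def conformalCoeff (e : Euc d) (u : Euc k → Euc d) (y : Euc k) : Euc k :=
  tangentialCoeff (fderivWithin ℝ u (range (𝓡∂ k)) y) (conformalField e (u y))

theorem contDiffWithinAt_fderivWithin {G : Type*} [NormedAddCommGroup G] [NormedSpace ℝ G]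
    {f : Euc k → G} {y : Euc k} (hy : y ∈ range (𝓡∂ k))
    (hf : ContDiffWithinAt ℝ ∞ f (range (𝓡∂ k)) y) :
    ContDiffWithinAt ℝ ∞ (fderivWithin ℝ f (range (𝓡∂ k))) (range (𝓡∂ k)) y :=
  hf.fderivWithin_right (𝓡∂ k).uniqueDiffOn (by simp) hy

theorem contDiffWithinAt_areaDensity {y : Euc k} (hy : y ∈ range (𝓡∂ k))
    (hu : ContDiffWithinAt ℝ ∞ u (range (𝓡∂ k)) y)
    (hinj : Function.Injective (fderivWithin ℝ u (range (𝓡∂ k)) y)) :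
    ContDiffWithinAt ℝ ∞ (areaDensity u) (range (𝓡∂ k)) y :=
  contDiffWithinAt_sqrt_det (contDiffWithinAt_fderivWithin hy hu) hinj

theorem contDiffWithinAt_conformalCoeff {y : Euc k} (hy : y ∈ range (𝓡∂ k))
    (hu : ContDiffWithinAt ℝ ∞ u (range (𝓡∂ k)) y)
    (hinj : Function.Injective (fderivWithin ℝ u (range (𝓡∂ k)) y)) (e : Euc d) :
    ContDiffWithinAt ℝ ∞ (conformalCoeff e u) (range (𝓡∂ k)) y :=
  contDiffWithinAt_tangentialCoeff (contDiffWithinAt_fderivWithin hy hu) hinj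
    ((contDiff_conformalField e).contDiffAt.comp_contDiffWithinAt y hu)

/-- On a piece of a minimal submanifold, the divergence of the tangential part of the conformal
field with respect to `e` is `2k⟨x, e⟩`. -/
theorem divergence_conformalField {y : Euc k} (hy : 0 < y 0)
    (hu : ContDiffWithinAt ℝ ∞ u (range (𝓡∂ k)) y)
    (hinj : Function.Injective (fderivWithin ℝ u (range (𝓡∂ k)) y))
    (hmin : meanCurvatureVector u y = 0) (e : Euc d) :
    ∃ (J' : Euc k →L[ℝ] ℝ) (X' : Euc k →L[ℝ] Euc k),
      HasFDerivAt (areaDensity u) J' y ∧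
      HasFDerivAt (conformalCoeff e u) X' y ∧
      J' (conformalCoeff e u y) + areaDensity u y * ∑ i, X' (stdVec i) i =
        areaDensity u y * (2 * k * inner ℝ (u y) e) := by
  have hH := range_mem_nhds hy
  have hyH : y ∈ range (𝓡∂ k) := mem_of_mem_nhds hH
  have hL : ContDiffWithinAt ℝ ∞ (fderivWithin ℝ u (range (𝓡∂ k))) (range (𝓡∂ k)) y :=
    contDiffWithinAt_fderivWithin hyH hu
  have hL1 : ContDiffAt ℝ 1 (fderivWithin ℝ u (range (𝓡∂ k))) y :=
    (hL.contDiffAt hH).of_le (by simp)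
  have hDL : HasFDerivAt (fderivWithin ℝ u (range (𝓡∂ k)))
      (fderivWithin ℝ (fderivWithin ℝ u (range (𝓡∂ k))) (range (𝓡∂ k)) y) y := by
    rw [fderivWithin_of_mem_nhds hH]
    exact (hL1.differentiableAt one_ne_zero).hasFDerivAt
  have hdu : HasFDerivAt u (fderivWithin ℝ u (range (𝓡∂ k)) y) y := by
    rw [fderivWithin_of_mem_nhds hH]
    exact ((hu.contDiffAt hH).differentiableAt (by simp)).hasFDerivAt
  obtain ⟨DY, hDY, hDYv⟩ := hasFDerivAt_conformalField_comp e hdu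
  have hsymm : IsSymmSndFDerivWithinAt ℝ u (range (𝓡∂ k)) y :=
    hu.isSymmSndFDerivWithinAt
      (by simpa using WithTop.coe_le_coe.2 (le_top : (2 : ℕ∞) ≤ ⊤)) (𝓡∂ k).uniqueDiffOn
      (subset_closure (mem_interior_iff_mem_nhds.2 hH)) hyH
  obtain ⟨J', X', hJ', hX', h⟩ := divergence_tangentialCoeff hL1 hDL (fun v w => hsymm.eq v w) hinj
    (fun N hN => sum_inner_secondDeriv_eq_zero hmin hN)
    ((contDiff_conformalField e).contDiffAt.comp y
      ((hu.contDiffAt hH).of_le (by simp))) hDY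
  refine ⟨J', X', hJ', hX', h.trans ?_⟩
  rw [trace_conformalField hinj e (u y) hDYv, areaDensity_eq]

/-- The weak form of the divergence formula, in a chart: no boundary term appears as the conformal
field is tangent to the boundary. -/
theorem setIntegral_conformalField_eq_zero (hTH : T ⊆ range (𝓡∂ k))
    (hu : ∀ y ∈ T, ContDiffWithinAt ℝ ∞ u (range (𝓡∂ k)) y)
    (hinj : ∀ y ∈ T, Function.Injective (fderivWithin ℝ u (range (𝓡∂ k)) y))
    (hmin : ∀ y ∈ T, meanCurvatureVector u y = 0) (e : Euc d)
    (htan : ∀ y ∈ T, y 0 = 0 → conformalCoeff e u y 0 = 0)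
    {ρ : Euc k → ℝ} {K : Set (Euc k)} (hK : IsCompact K) (hKT : K ⊆ T)
    (hρ : ∀ y ∈ T, ContDiffWithinAt ℝ ∞ ρ (range (𝓡∂ k)) y) (hρ0 : ∀ y ∉ K, ρ y = 0) :
    ∫ y in T, areaDensity u y * (fderivWithin ℝ ρ (range (𝓡∂ k)) y (conformalCoeff e u y) +
      2 * k * inner ℝ (u y) e * ρ y) = 0 := by
  have hHeq := range_modelWithCornersEuclideanHalfSpace k
  set X : Euc k → Euc k := conformalCoeff e u with hXdef
  set D : Euc k → ℝ := fun y => areaDensity u y *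
    (fderivWithin ℝ ρ (range (𝓡∂ k)) y (X y) + 2 * k * inner ℝ (u y) e * ρ y) with hDdef
  set F : Euc k → Euc k := fun y => (ρ y * areaDensity u y) • X y with hFdef
  -- `K` is closed, so a point either lies in `K ⊆ T`, where all data are smooth, or has a
  -- neighbourhood on which `ρ` vanishes. The regularity claims below split in this way, as `u` is
  -- uncontrolled off `T`.
  have hρev : ∀ y ∉ K, ρ =ᶠ[𝓝 y] fun _ => 0 := fun y hy =>
    Filter.mem_of_superset (hK.isClosed.isOpen_compl.mem_nhds hy) hρ0
  have hD0 : ∀ y ∉ K, D y = 0 := by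
    intro y hy
    have : fderivWithin ℝ ρ (range (𝓡∂ k)) y = 0 := by
      rw [(hρev y hy).fderivWithin_eq_of_nhds, fderivWithin_fun_const]
      rfl
    simp only [hDdef, this, hρ0 y hy]
    simp
  have hF0 : ∀ y ∉ K, F y = 0 := fun y hy => by simp [hFdef, hρ0 y hy]
  have hDev : ∀ y ∉ K, D =ᶠ[𝓝 y] fun _ => 0 := fun y hy =>
    Filter.mem_of_superset (hK.isClosed.isOpen_compl.mem_nhds hy) hD0
  have hFev : ∀ y ∉ K, F =ᶠ[𝓝 y] fun _ => 0 := fun y hy =>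
    Filter.mem_of_superset (hK.isClosed.isOpen_compl.mem_nhds hy) hF0
  have hJs := fun y hy => contDiffWithinAt_areaDensity (hTH hy) (hu y hy) (hinj y hy)
  have hXs := fun y hy => contDiffWithinAt_conformalCoeff (hTH hy) (hu y hy) (hinj y hy) e
  have hDc : ContinuousOn D {y | 0 ≤ y 0} := by
    rw [← hHeq]
    intro y _
    by_cases hyK : y ∈ K
    · have hy := hKT hyK
      exact (hJs y hy).continuousWithinAt.mul
        (((contDiffWithinAt_fderivWithin (hTH hy) (hρ y hy)).continuousWithinAt.clm_apply
          (hXs y hy).continuousWithinAt).add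
          ((continuousWithinAt_const.mul
            ((hu y hy).continuousWithinAt.inner continuousWithinAt_const)).mul
            (hρ y hy).continuousWithinAt))
    · exact (continuousAt_const.congr (hDev y hyK).symm).continuousWithinAt
  have hFc : ContinuousOn F {y | 0 ≤ y 0} := by
    rw [← hHeq]
    intro y _
    by_cases hyK : y ∈ K
    · have hy := hKT hyK
      exact ((hρ y hy).continuousWithinAt.mul (hJs y hy).continuousWithinAt).smul
        (hXs y hy).continuousWithinAt
    · exact (continuousAt_const.congr (hFev y hyK).symm).continuousWithinAt
  have hderiv : ∀ y : Euc k, 0 < y 0 → ∃ F' : Euc k →L[ℝ] Euc k,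
      HasFDerivAt F F' y ∧ D y = ∑ i, F' (stdVec i) i := by
    intro y hy0
    by_cases hyK : y ∈ K
    · have hy := hKT hyK
      have hH := range_mem_nhds hy0
      obtain ⟨J', X', hJ', hX', h⟩ :=
        divergence_conformalField hy0 (hu y hy) (hinj y hy) (hmin y hy) e
      have hρ' : HasFDerivAt ρ (fderivWithin ℝ ρ (range (𝓡∂ k)) y) y := by
        rw [fderivWithin_of_mem_nhds hH]
        exact (((hρ y hy).contDiffAt hH).differentiableAt (by simp)).hasFDerivAt
      refine ⟨_, (hρ'.mul hJ').smul hX', ?_⟩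
      set ρ' := fderivWithin ℝ ρ (range (𝓡∂ k)) y
      have e1 : ∑ i, ρ' (stdVec i) * X y i = ρ' (X y) := by
        rw [map_eq_sum ρ' (X y)]
        exact Finset.sum_congr rfl fun i _ => mul_comm _ _
      have e2 : ∑ i, J' (stdVec i) * X y i = J' (X y) := by
        rw [map_eq_sum J' (X y)]
        exact Finset.sum_congr rfl fun i _ => mul_comm _ _
      have e3 : ∀ i, (((ρ * areaDensity u) y • X' + ContinuousLinearMap.smulRight
          (ρ y • J' + areaDensity u y • ρ') (X y)) (stdVec i)) i =
          ρ y * areaDensity u y * X' (stdVec i) i + ρ y * (J' (stdVec i) * X y i)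
          + areaDensity u y * (ρ' (stdVec i) * X y i) := by
        intro i
        simp
        ring
      refine Eq.trans ?_ (Finset.sum_congr rfl fun i _ => (e3 i).symm)
      rw [Finset.sum_add_distrib, Finset.sum_add_distrib, ← Finset.mul_sum, ← Finset.mul_sum,
        ← Finset.mul_sum, e1, e2]
      simp only [hDdef]
      linear_combination (-ρ y) * h
    · exact ⟨0, (hasFDerivAt_const 0 y).congr_of_eventuallyEq (hFev y hyK), by
        simp [hD0 y hyK]⟩
  choose! F' hF' hDF using hderiv
  have h := setIntegral_halfSpace_divergence_eq_zero hK hFc hF0 ?_ hF' hDc hD0 hDF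
  · rw [← hHeq] at h
    rw [← h]
    refine (setIntegral_eq_of_subset_of_forall_sdiff_eq_zero
      (𝓡∂ k).isClosed_range.measurableSet hTH fun y hy => hD0 y fun hyK => hy.2 (hKT hyK)).symm
  · intro y hy
    by_cases hyK : y ∈ K
    · have := htan y (hKT hyK) hy
      simp [hFdef, this]
    · rw [hF0 y hyK]
      rfl

end LocalComputation

/-! ### Derivatives in different charts -/

section Charts

variable {k d : ℕ} [NeZero k] {M : Type*} [TopologicalSpace M]
  [ChartedSpace (EuclideanHalfSpace k) M]
  {G : Type*} [NormedAddCommGroup G] [NormedSpace ℝ G]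

/-- The derivative at `p` of a map `f` on `M`, read in the chart around `q`. -/
def chartDeriv (f : M → G) (q p : M) : Euc k →L[ℝ] G :=
  fderivWithin ℝ (f ∘ (extChartAt (𝓡∂ k) q).symm) (range (𝓡∂ k)) (extChartAt (𝓡∂ k) q p)

theorem mfderiv_eq_chartDeriv {f : M → G} (hf : ContMDiff (𝓡∂ k) 𝓘(ℝ, G) ∞ f) (p : M) :
    (mfderiv (𝓡∂ k) 𝓘(ℝ, G) f p : Euc k →L[ℝ] G) = chartDeriv f p p :=
  (hf.mdifferentiable (by simp) p).mfderiv

theorem chartDeriv_eq_zero_of_notMem_tsupport {ρ : M → ℝ} {p : M} (hp : p ∉ tsupport ρ) :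
    chartDeriv (k := k) ρ p p = 0 := by
  have h : (ρ ∘ (extChartAt (𝓡∂ k) p).symm) =ᶠ[𝓝 (extChartAt (𝓡∂ k) p p)] fun _ => 0 := by
    have hc : Filter.Tendsto (extChartAt (𝓡∂ k) p).symm (𝓝 (extChartAt (𝓡∂ k) p p)) (𝓝 p) := by
      simpa only [ContinuousAt, extChartAt_to_inv] using
        continuousAt_extChartAt_symm (I := 𝓡∂ k) p
    exact hc.eventually (notMem_tsupport_iff_eventuallyEq.1 hp)
  rw [chartDeriv, h.fderivWithin_eq_of_nhds, fderivWithin_fun_const]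
  rfl

variable [IsManifold (𝓡∂ k) ∞ M]

theorem contDiffWithinAt_comp_extChartAt_symm {f : M → G} (hf : ContMDiff (𝓡∂ k) 𝓘(ℝ, G) ∞ f)
    {q : M} {y : Euc k} (hy : y ∈ (extChartAt (𝓡∂ k) q).target) :
    ContDiffWithinAt ℝ ∞ (f ∘ (extChartAt (𝓡∂ k) q).symm) (range (𝓡∂ k)) y := by
  have h : ContMDiffOn 𝓘(ℝ, Euc k) 𝓘(ℝ, G) ∞ (f ∘ (extChartAt (𝓡∂ k) q).symm)
      (extChartAt (𝓡∂ k) q).target := hf.comp_contMDiffOn (contMDiffOn_extChartAt_symm q)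
  exact (contMDiffOn_iff_contDiffOn.1 h y hy).mono_of_mem_nhdsWithin
    (extChartAt_target_mem_nhdsWithin_of_mem hy)

theorem tangentCoordChange_inverse {q q' p : M} (hq : p ∈ (extChartAt (𝓡∂ k) q).source)
    (hq' : p ∈ (extChartAt (𝓡∂ k) q').source) (v : Euc k) :
    tangentCoordChange (𝓡∂ k) q' q p (tangentCoordChange (𝓡∂ k) q q' p v) = v := by
  rw [tangentCoordChange_comp ⟨⟨hq, hq'⟩, hq⟩, tangentCoordChange_self hq]

/-- The chain rule within the half-space. Chart independence of the area and of the conformal field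
both rest on it. -/
theorem chartDeriv_eq_comp {f : M → G} (hf : ContMDiff (𝓡∂ k) 𝓘(ℝ, G) ∞ f) {q q' p : M}
    (hq : p ∈ (extChartAt (𝓡∂ k) q).source) (hq' : p ∈ (extChartAt (𝓡∂ k) q').source) :
    chartDeriv f q p = (chartDeriv f q' p).comp (tangentCoordChange (𝓡∂ k) q q' p) := by
  have h1 : HasFDerivWithinAt (f ∘ (extChartAt (𝓡∂ k) q').symm) (chartDeriv f q' p)
      (range (𝓡∂ k)) (extChartAt (𝓡∂ k) q' p) :=
    ((contDiffWithinAt_comp_extChartAt_symm hf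
      ((extChartAt (𝓡∂ k) q').map_source hq')).differentiableWithinAt (by simp)).hasFDerivWithinAt
  have h2 := hasFDerivWithinAt_tangentCoordChange (I := 𝓡∂ k) ⟨hq, hq'⟩
  have hpt : (extChartAt (𝓡∂ k) q' ∘ (extChartAt (𝓡∂ k) q).symm) (extChartAt (𝓡∂ k) q p) =
      extChartAt (𝓡∂ k) q' p := by
    rw [Function.comp_apply, (extChartAt (𝓡∂ k) q).left_inv hq]
  rw [← hpt] at h1
  have h3 := h1.comp _ h2 (fun y _ => by
    rw [Function.comp_apply, extChartAt_coe]
    exact mem_range_self _)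
  have hev : ∀ᶠ y in 𝓝[range (𝓡∂ k)] (extChartAt (𝓡∂ k) q p),
      (extChartAt (𝓡∂ k) q).symm y ∈ (extChartAt (𝓡∂ k) q').source := by
    have hc := continuousAt_extChartAt_symm' (I := 𝓡∂ k) hq
    have : (extChartAt (𝓡∂ k) q').source ∈
        𝓝 ((extChartAt (𝓡∂ k) q).symm (extChartAt (𝓡∂ k) q p)) := by
      rw [(extChartAt (𝓡∂ k) q).left_inv hq]
      exact extChartAt_source_mem_nhds' hq'
    exact (hc.eventually this).filter_mono nhdsWithin_le_nhds
  have hyH : extChartAt (𝓡∂ k) q p ∈ range (𝓡∂ k) :=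
    extChartAt_target_subset_range q ((extChartAt (𝓡∂ k) q).map_source hq)
  refine HasFDerivWithinAt.fderivWithin ?_ ((𝓡∂ k).uniqueDiffOn _ hyH)
  refine h3.congr_of_eventuallyEq ?_ ?_
  · filter_upwards [hev] with y hy
    simp only [Function.comp_apply]
    rw [(extChartAt (𝓡∂ k) q').left_inv hy]
  · simp only [Function.comp_apply]
    rw [(extChartAt (𝓡∂ k) q').left_inv]
    rwa [(extChartAt (𝓡∂ k) q).left_inv hq]

variable {x : M → Euc d}

theorem IsSmoothImmersion.chartDeriv_injective (hx : IsSmoothImmersion k x) {q p : M}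
    (hq : p ∈ (extChartAt (𝓡∂ k) q).source) : Function.Injective (chartDeriv (k := k) x q p) := by
  have hp := mem_extChartAt_source (I := 𝓡∂ k) p
  rw [chartDeriv_eq_comp hx.smooth hq hp]
  have h := hx.injective_mfderiv p
  have h2 : Function.Injective (chartDeriv (k := k) x p p) := by
    rw [← mfderiv_eq_chartDeriv hx.smooth]
    exact h
  exact h2.comp (Function.LeftInverse.injective (tangentCoordChange_inverse hq hp))

theorem IsSmoothImmersion.fderivWithin_localParam_injective (hx : IsSmoothImmersion k x) {q : M}
    {y : Euc k} (hy : y ∈ (extChartAt (𝓡∂ k) q).target) :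
    Function.Injective (fderivWithin ℝ (localParam k x q) (range (𝓡∂ k)) y) := by
  have h := hx.chartDeriv_injective ((extChartAt (𝓡∂ k) q).map_target hy)
  rw [chartDeriv, (extChartAt (𝓡∂ k) q).right_inv hy] at h
  exact h

theorem IsSmoothImmersion.continuousOn_areaDensity (hx : IsSmoothImmersion k x) (q : M) :
    ContinuousOn (areaDensity (localParam k x q)) (extChartAt (𝓡∂ k) q).target := fun _ hy =>
  (contDiffWithinAt_areaDensity (extChartAt_target_subset_range q hy)
    (contDiffWithinAt_comp_extChartAt_symm hx.smooth hy)
    (hx.fderivWithin_localParam_injective hy)).continuousWithinAt.mono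
    (extChartAt_target_subset_range q)

theorem areaDensity_localParam_eq (hx : IsSmoothImmersion k x) {q q' p : M}
    (hq : p ∈ (extChartAt (𝓡∂ k) q).source) (hq' : p ∈ (extChartAt (𝓡∂ k) q').source) :
    areaDensity (localParam k x q) (extChartAt (𝓡∂ k) q p) =
      |(tangentCoordChange (𝓡∂ k) q q' p).det| *
        areaDensity (localParam k x q') (extChartAt (𝓡∂ k) q' p) := by
  have h := sqrt_det_gramMatrix_comp (chartDeriv x q' p) (tangentCoordChange (𝓡∂ k) q q' p)
  rw [← chartDeriv_eq_comp hx.smooth hq hq'] at h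
  exact h

end Charts

/-! ### The area measure -/

section Area

variable {k d : ℕ} [NeZero k] {M : Type*} [TopologicalSpace M]
  [ChartedSpace (EuclideanHalfSpace k) M]

theorem areaDensity_nonneg (u : Euc k → Euc d) (y : Euc k) : 0 ≤ areaDensity u y :=
  Real.sqrt_nonneg _

theorem measurableSet_extChartAt_target (q : M) :
    MeasurableSet (extChartAt (𝓡∂ k) q).target := by
  rw [extChartAt_target]
  exact (((chartAt (EuclideanHalfSpace k) q).open_target.preimage
    (𝓡∂ k).continuous_symm).measurableSet).inter (𝓡∂ k).isClosed_range.measurableSet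

variable [MeasurableSpace M] [BorelSpace M]

theorem aemeasurable_extChartAt_symm (q : M) :
    AEMeasurable (extChartAt (𝓡∂ k) q).symm
      ((volume : Measure (Euc k)).restrict (extChartAt (𝓡∂ k) q).target) :=
  (continuousOn_extChartAt_symm q).aemeasurable (measurableSet_extChartAt_target q)

theorem measurableSet_extChartAt_image {q : M} {A : Set M} (hA : MeasurableSet A)
    (hAq : A ⊆ (extChartAt (𝓡∂ k) q).source) : MeasurableSet (extChartAt (𝓡∂ k) q '' A) := by
  rw [(extChartAt (𝓡∂ k) q).image_eq_target_inter_inv_preimage hAq]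
  have h : Measurable ((extChartAt (𝓡∂ k) q).target.domRestrict (extChartAt (𝓡∂ k) q).symm) :=
    (continuousOn_extChartAt_symm q).domRestrict.measurable
  have h2 := (measurableSet_extChartAt_target q).subtype_image (h hA)
  convert h2 using 1
  ext y
  constructor
  · exact fun hy => ⟨⟨y, hy.1⟩, hy.2, rfl⟩
  · rintro ⟨z, hz, rfl⟩
    exact ⟨z.2, hz⟩

theorem chartArea_apply (x : M → Euc d) (q : M) {A : Set M} (hA : MeasurableSet A) :
    chartArea k x q A = ∫⁻ y in extChartAt (𝓡∂ k) q '' (A ∩ (extChartAt (𝓡∂ k) q).source),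
      ENNReal.ofReal (areaDensity (localParam k x q) y) := by
  rw [chartArea, Measure.map_apply_of_aemeasurable
    ((aemeasurable_extChartAt_symm q).mono_ac (withDensity_absolutelyContinuous _ _)) hA,
    withDensity_apply', Measure.restrict_restrict' (measurableSet_extChartAt_target q),
    (extChartAt (𝓡∂ k) q).image_eq_target_inter_inv_preimage inter_subset_right]
  congr 2
  ext y
  constructor
  · exact fun h => ⟨h.2, h.1, (extChartAt (𝓡∂ k) q).map_target h.2⟩
  · exact fun h => ⟨h.2.1, h.1⟩

theorem chartArea_inter_source (x : M → Euc d) (q : M) {A : Set M} (hA : MeasurableSet A) :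
    chartArea k x q (A ∩ (extChartAt (𝓡∂ k) q).source) = chartArea k x q A := by
  rw [chartArea_apply x q hA,
    chartArea_apply x q (hA.inter (isOpen_extChartAt_source q).measurableSet), inter_assoc,
    inter_self]

variable [IsManifold (𝓡∂ k) ∞ M] {x : M → Euc d}

/-- The area measures of the chart domains agree on overlaps. -/
theorem chartArea_eq_of_subset (hx : IsSmoothImmersion k x) {q q' : M} {A : Set M}
    (hA : MeasurableSet A) (hq : A ⊆ (extChartAt (𝓡∂ k) q).source)
    (hq' : A ⊆ (extChartAt (𝓡∂ k) q').source) : chartArea k x q A = chartArea k x q' A := by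
  rw [chartArea_apply x q hA, chartArea_apply x q' hA, inter_eq_left.2 hq, inter_eq_left.2 hq']
  set f := extChartAt (𝓡∂ k) q' ∘ (extChartAt (𝓡∂ k) q).symm with hf
  have hfA : ∀ p ∈ A, f (extChartAt (𝓡∂ k) q p) = extChartAt (𝓡∂ k) q' p := fun p hp => by
    rw [hf, Function.comp_apply, (extChartAt (𝓡∂ k) q).left_inv (hq hp)]
  have himage : extChartAt (𝓡∂ k) q' '' A = f '' (extChartAt (𝓡∂ k) q '' A) := by
    rw [image_image]
    exact (image_congr hfA).symm
  have hsub : extChartAt (𝓡∂ k) q '' A ⊆ range (𝓡∂ k) := by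
    rintro _ ⟨p, hp, rfl⟩
    exact extChartAt_target_subset_range q ((extChartAt (𝓡∂ k) q).map_source (hq hp))
  rw [himage, lintegral_image_eq_lintegral_abs_det_fderiv_mul volume
    (measurableSet_extChartAt_image hA hq)
    (f' := fun y => tangentCoordChange (𝓡∂ k) q q' ((extChartAt (𝓡∂ k) q).symm y))]
  · refine setLIntegral_congr_fun (measurableSet_extChartAt_image hA hq) ?_
    rintro _ ⟨p, hp, rfl⟩
    simp only [hfA p hp, (extChartAt (𝓡∂ k) q).left_inv (hq hp)]
    rw [areaDensity_localParam_eq hx (hq hp) (hq' hp), ENNReal.ofReal_mul (abs_nonneg _)]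
  · rintro _ ⟨p, hp, rfl⟩
    rw [(extChartAt (𝓡∂ k) q).left_inv (hq hp)]
    exact (hasFDerivWithinAt_tangentCoordChange ⟨hq hp, hq' hp⟩).mono hsub
  · rintro _ ⟨p, hp, rfl⟩ _ ⟨p', hp', rfl⟩ h
    rw [hfA p hp, hfA p' hp'] at h
    rw [(extChartAt (𝓡∂ k) q').injOn (hq' hp) (hq' hp') h]

/-- The area measure equals `√(det g) dy` in every chart. -/
theorem areaMeasure_restrict_source (hx : IsSmoothImmersion k x) (q : M) :
    (areaMeasure k x).restrict (extChartAt (𝓡∂ k) q).source = chartArea k x q := by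
  have hU : MeasurableSet (extChartAt (𝓡∂ k) q).source :=
    (isOpen_extChartAt_source q).measurableSet
  refine le_antisymm ?_ ?_
  -- A supremum of measures is not computed set by set, so it is bounded by a single measure: the
  -- area in the chart at `q` on its domain, and the largest possible measure elsewhere, which the
  -- restriction then discards.
  · have hle : areaMeasure k x ≤ (chartArea k x q).restrict (extChartAt (𝓡∂ k) q).source +
        (⊤ : Measure M).restrict (extChartAt (𝓡∂ k) q).sourceᶜ := by
      refine iSup_le fun q' => Measure.le_iff.2 fun A hA => ?_
      rw [Measure.add_apply, Measure.restrict_apply hA, Measure.restrict_apply hA,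
        ← measure_inter_add_sdiff A hU]
      refine add_le_add ?_ ?_
      · rw [← chartArea_inter_source x q' (hA.inter hU), ← chartArea_eq_of_subset hx
          ((hA.inter hU).inter (isOpen_extChartAt_source q').measurableSet)
          (inter_subset_left.trans inter_subset_right) inter_subset_right]
        exact measure_mono inter_subset_left
      · exact Measure.le_iff'.1 le_top _
    refine (Measure.restrict_mono_measure hle _).trans ?_
    rw [Measure.restrict_add, Measure.restrict_restrict hU, Measure.restrict_restrict hU,
      inter_self, inter_compl_self, Measure.restrict_empty, add_zero]
    exact Measure.restrict_le_self
  · refine Measure.le_iff.2 fun A hA => ?_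
    rw [Measure.restrict_apply hA, ← chartArea_inter_source x q hA]
    exact Measure.le_iff'.1 (le_iSup (chartArea k x) q) _

/-- By compactness local finiteness suffices: near `q` the density is bounded and the coordinates
stay in a ball. -/
theorem areaMeasure_finite [CompactSpace M] (hx : IsSmoothImmersion k x) :
    IsFiniteMeasure (areaMeasure k x) := by
  have hloc : IsLocallyFiniteMeasure (areaMeasure k x) := by
    refine ⟨fun q => ?_⟩
    have hJ : ContinuousAt
        (fun p => areaDensity (localParam k x q) (extChartAt (𝓡∂ k) q p)) q :=
      ((hx.continuousOn_areaDensity q).comp (continuousOn_extChartAt q)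
        (extChartAt (𝓡∂ k) q).mapsTo).continuousAt (extChartAt_source_mem_nhds q)
    set C := areaDensity (localParam k x q) (extChartAt (𝓡∂ k) q q) + 1
    obtain ⟨A, hAsub, hAo, hqA⟩ := mem_nhds_iff.1 (((hJ.eventually_lt continuousAt_const
      (lt_add_one _)).and ((continuousAt_extChartAt q).eventually_mem
        (Metric.ball_mem_nhds (extChartAt (𝓡∂ k) q q) one_pos))).and
        (extChartAt_source_mem_nhds (I := 𝓡∂ k) q))
    have hAU : A ⊆ (extChartAt (𝓡∂ k) q).source := fun p hp => (hAsub hp).2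
    refine ⟨A, hAo.mem_nhds hqA, ?_⟩
    rw [← inter_eq_left.2 hAU, ← Measure.restrict_apply hAo.measurableSet,
      areaMeasure_restrict_source hx, chartArea_apply x q hAo.measurableSet, inter_eq_left.2 hAU]
    calc ∫⁻ y in extChartAt (𝓡∂ k) q '' A, ENNReal.ofReal (areaDensity (localParam k x q) y)
        ≤ ∫⁻ _ in extChartAt (𝓡∂ k) q '' A, ENNReal.ofReal C := by
          refine setLIntegral_mono' (measurableSet_extChartAt_image hAo.measurableSet hAU) ?_
          rintro _ ⟨p, hp, rfl⟩
          exact ENNReal.ofReal_le_ofReal (hAsub hp).1.1.le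
      _ = ENNReal.ofReal C * volume (extChartAt (𝓡∂ k) q '' A) := setLIntegral_const _ _
      _ < ⊤ := ENNReal.mul_lt_top ENNReal.ofReal_lt_top
          ((measure_mono (t := Metric.ball (extChartAt (𝓡∂ k) q q) 1) (by
            rintro _ ⟨p, hp, rfl⟩
            exact (hAsub hp).1.2)).trans_lt measure_ball_lt_top)
  infer_instance

/-- Integrals of functions supported in a chart domain. -/
theorem integral_areaMeasure_eq (hx : IsSmoothImmersion k x) {q : M} {f : M → ℝ}
    (hf : Continuous f) (hfq : ∀ p ∉ (extChartAt (𝓡∂ k) q).source, f p = 0) :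
    ∫ p, f p ∂(areaMeasure k x) = ∫ y in (extChartAt (𝓡∂ k) q).target,
      areaDensity (localParam k x q) y * f ((extChartAt (𝓡∂ k) q).symm y) := by
  rw [← setIntegral_eq_integral_of_forall_compl_eq_zero hfq, areaMeasure_restrict_source hx,
    chartArea, integral_map
    ((aemeasurable_extChartAt_symm q).mono_ac (withDensity_absolutelyContinuous _ _))
    hf.measurable.aestronglyMeasurable]
  have hm : AEMeasurable (fun y => ENNReal.ofReal (areaDensity (localParam k x q) y))
      (volume.restrict (extChartAt (𝓡∂ k) q).target) :=
    ((hx.continuousOn_areaDensity q).aemeasurable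
      (measurableSet_extChartAt_target q)).ennreal_ofReal
  rw [integral_withDensity_eq_integral_toReal_smul₀ hm (by simp)]
  refine integral_congr_ae (Filter.Eventually.of_forall fun y => ?_)
  simp only [smul_eq_mul]
  rw [ENNReal.toReal_ofReal (areaDensity_nonneg _ _)]

end Area

/-! ### The tangential conformal field on the manifold -/

section ConformalVector

variable {k d : ℕ} [NeZero k] {M : Type*} [TopologicalSpace M]
  [ChartedSpace (EuclideanHalfSpace k) M] [IsManifold (𝓡∂ k) ∞ M] {x : M → Euc d}

variable (k) in
/-- The tangential part of the conformal field along `x`, as a tangent vector of `M` at `p`. -/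
def conformalVector (e : Euc d) (x : M → Euc d) (p : M) : Euc k :=
  tangentialCoeff (chartDeriv x p p) (conformalField e (x p))

theorem tangentCoordChange_conformalCoeff (hx : IsSmoothImmersion k x) (e : Euc d) {q p : M}
    (hq : p ∈ (extChartAt (𝓡∂ k) q).source) :
    tangentCoordChange (𝓡∂ k) q p p
      (conformalCoeff e (localParam k x q) (extChartAt (𝓡∂ k) q p)) = conformalVector k e x p := by
  have hp := mem_extChartAt_source (I := 𝓡∂ k) p
  have h := map_tangentialCoeff_comp (hx.chartDeriv_injective hp)
    (tangentCoordChange_inverse hq hp) (tangentCoordChange_inverse hp hq) (conformalField e (x p))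
  rw [← chartDeriv_eq_comp hx.smooth hq hp] at h
  rw [conformalCoeff, localParam, Function.comp_apply, (extChartAt (𝓡∂ k) q).left_inv hq]
  exact h

/-- The derivative of `ρ` in the direction of the conformal field can be computed in any chart. -/
theorem chartDeriv_conformalVector (hx : IsSmoothImmersion k x) (e : Euc d) {ρ : M → ℝ}
    (hρ : ContMDiff (𝓡∂ k) 𝓘(ℝ, ℝ) ∞ ρ) {q p : M} (hq : p ∈ (extChartAt (𝓡∂ k) q).source) :
    chartDeriv ρ p p (conformalVector k e x p) = chartDeriv ρ q p
      (conformalCoeff e (localParam k x q) (extChartAt (𝓡∂ k) q p)) := by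
  rw [chartDeriv_eq_comp hρ hq (mem_extChartAt_source p), ContinuousLinearMap.comp_apply,
    tangentCoordChange_conformalCoeff hx e hq]

/-- The chart at `p` may jump with `p`, so continuity is not visible from the expression; near `q`
it is rewritten in the fixed chart at `q`. -/
theorem continuous_chartDeriv_conformalVector (hx : IsSmoothImmersion k x) (e : Euc d) {ρ : M → ℝ}
    (hρ : ContMDiff (𝓡∂ k) 𝓘(ℝ, ℝ) ∞ ρ) :
    Continuous fun p => chartDeriv ρ p p (conformalVector k e x p) := by
  refine continuous_iff_continuousAt.2 fun q => ?_
  have h : ContinuousOn (fun y => fderivWithin ℝ (ρ ∘ (extChartAt (𝓡∂ k) q).symm) (range (𝓡∂ k)) y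
      (conformalCoeff e (localParam k x q) y)) (extChartAt (𝓡∂ k) q).target := by
    intro y hy
    have hyH := extChartAt_target_subset_range q hy
    exact ((contDiffWithinAt_fderivWithin hyH
      (contDiffWithinAt_comp_extChartAt_symm hρ hy)).continuousWithinAt.clm_apply
      (contDiffWithinAt_conformalCoeff hyH (contDiffWithinAt_comp_extChartAt_symm hx.smooth hy)
        (hx.fderivWithin_localParam_injective hy) e).continuousWithinAt).mono
      (extChartAt_target_subset_range q)
  refine ((h.comp (continuousOn_extChartAt q) (extChartAt (𝓡∂ k) q).mapsTo).continuousAt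
    (extChartAt_source_mem_nhds q)).congr ?_
  filter_upwards [extChartAt_source_mem_nhds (I := 𝓡∂ k) q] with p hp
  exact (chartDeriv_conformalVector hx e hρ hp).symm

theorem continuous_divergence_conformalVector (hx : IsSmoothImmersion k x) (e : Euc d) {ρ : M → ℝ}
    (hρ : ContMDiff (𝓡∂ k) 𝓘(ℝ, ℝ) ∞ ρ) :
    Continuous fun p =>
      chartDeriv ρ p p (conformalVector k e x p) + 2 * k * inner ℝ (x p) e * ρ p :=
  (continuous_chartDeriv_conformalVector hx e hρ).add
    ((continuous_const.mul (hx.smooth.continuous.inner continuous_const)).mul hρ.continuous)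

/-- Coordinate changes preserve the tangent space of the boundary. -/
theorem tangentCoordChange_apply_zero {p q : M} (hq : p ∈ (extChartAt (𝓡∂ k) q).source)
    (hp0 : extChartAt (𝓡∂ k) p p 0 = 0) (hq0 : extChartAt (𝓡∂ k) q p 0 = 0) {w : Euc k}
    (hw : w 0 = 0) : tangentCoordChange (𝓡∂ k) p q p w 0 = 0 := by
  have hp := mem_extChartAt_source (I := 𝓡∂ k) p
  have hHeq := range_modelWithCornersEuclideanHalfSpace k
  set f := extChartAt (𝓡∂ k) q ∘ (extChartAt (𝓡∂ k) p).symm with hf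
  have h1 : HasFDerivWithinAt f (tangentCoordChange (𝓡∂ k) p q p) (range (𝓡∂ k))
      (extChartAt (𝓡∂ k) p p) := hasFDerivWithinAt_tangentCoordChange ⟨hp, hq⟩
  have hline : HasDerivAt (fun t : ℝ => extChartAt (𝓡∂ k) p p + t • w) w 0 := by
    simpa using ((hasDerivAt_id (0 : ℝ)).smul_const w).const_add (extChartAt (𝓡∂ k) p p)
  have hpt : extChartAt (𝓡∂ k) p p = extChartAt (𝓡∂ k) p p + (0 : ℝ) • w := by simp
  rw [hpt] at h1
  -- The whole line stays in the boundary hyperplane, so the derivative within the half-space gives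
  -- a two-sided derivative along it.
  have h2 : HasDerivAt (fun t : ℝ => f (extChartAt (𝓡∂ k) p p + t • w))
      (tangentCoordChange (𝓡∂ k) p q p w) 0 := by
    rw [← hasDerivWithinAt_univ] at hline ⊢
    refine h1.comp_hasDerivWithinAt (0 : ℝ) hline fun t _ => ?_
    rw [hHeq]
    show 0 ≤ extChartAt (𝓡∂ k) p p 0 + t * w 0
    rw [hp0, hw, mul_zero, add_zero]
  have h3 : HasDerivAt (fun t : ℝ => f (extChartAt (𝓡∂ k) p p + t • w) 0)
      (tangentCoordChange (𝓡∂ k) p q p w 0) 0 :=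
    (EuclideanSpace.proj 0 : Euc k →L[ℝ] ℝ).hasFDerivAt.comp_hasDerivAt (0 : ℝ) h2
  -- Values of `f` lie in the half-space even outside the chart's target, so the coordinate `0` of
  -- `f` is nonnegative along the line and vanishes at `t = 0`.
  refine IsLocalMin.hasDerivAt_eq_zero (Filter.Eventually.of_forall fun t => ?_) h3
  have h4 : f (extChartAt (𝓡∂ k) p p + (0 : ℝ) • w) 0 = 0 := by
    rw [← hpt, hf, Function.comp_apply, (extChartAt (𝓡∂ k) p).left_inv hp, hq0]
  have h5 : f (extChartAt (𝓡∂ k) p p + t • w) ∈ range (𝓡∂ k) := by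
    rw [hf, Function.comp_apply, extChartAt_coe]
    exact mem_range_self _
  rw [hHeq] at h5
  show f _ 0 ≤ f _ 0
  rw [h4]
  exact h5

theorem mem_boundary_of_extChartAt_zero {p q : M} (hq : p ∈ (extChartAt (𝓡∂ k) q).source)
    (hq0 : extChartAt (𝓡∂ k) q p 0 = 0) : p ∈ (𝓡∂ k).boundary M := by
  rw [extChartAt_source] at hq
  refine (ModelWithCorners.isBoundaryPoint_iff_of_mem_atlas (n := ∞) (by simp)
    (chart_mem_atlas (EuclideanHalfSpace k) q) hq).2 ?_
  rw [← extChartAt_source (𝓡∂ k)] at hq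
  refine ⟨subset_closure ((extChartAt (𝓡∂ k) q).map_source hq), fun h => ?_⟩
  have h2 := interior_mono (extChartAt_target_subset_range q) h
  rw [interior_range_modelWithCornersEuclideanHalfSpace] at h2
  exact (ne_of_gt h2) hq0

/-- The free boundary condition makes the tangential part of the conformal field tangent to the
boundary. -/
theorem conformalVector_apply_zero (hx : IsSmoothImmersion k x)
    (hfree : HasFreeBoundaryInUnitBall k x) (e : Euc d) {p : M} (hp : p ∈ (𝓡∂ k).boundary M) :
    conformalVector k e x p 0 = 0 := by
  have hinj := hx.chartDeriv_injective (mem_extChartAt_source (I := 𝓡∂ k) p)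
  obtain ⟨L, hLdef⟩ : ∃ L : Euc k →L[ℝ] Euc d, L = chartDeriv x p p := ⟨_, rfl⟩
  have hL : (mfderiv (𝓡∂ k) 𝓘(ℝ, Euc d) x p : Euc k →L[ℝ] Euc d) = L :=
    (mfderiv_eq_chartDeriv hx.smooth p).trans hLdef.symm
  have hcon := hfree.conormal p hp
  rw [IsOutwardUnitConormal, hL] at hcon
  rw [← hLdef] at hinj
  obtain ⟨⟨v, hv0, hv'⟩, hnorm, horth'⟩ := hcon
  have hv : L v = x p := hv'
  have horth : ∀ w : Euc k, w 0 = 0 → inner ℝ (x p) (L w) = 0 := horth'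
  set X := conformalVector k e x p with hX
  have h1 : inner ℝ (L X) (x p) = 0 := by
    rw [← hv, hX, conformalVector, ← hLdef, inner_tangentialCoeff hinj, hv,
      inner_conformalField_self e hnorm]
  -- With `L v = x p`, write `X = c v + w` where `w 0 = 0`. Pairing `L X` with the unit vector `x p`
  -- gives `c` by the conormal condition and `0` by `h1`.
  set c := X 0 / v 0 with hc
  have hw : (X - c • v) 0 = 0 := by
    simp [hc, div_mul_cancel₀ _ hv0.ne]
  have h2 := horth _ hw
  rw [map_sub, map_smul, hv, inner_sub_right, real_inner_comm, h1, real_inner_smul_right,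
    real_inner_self_eq_norm_sq, hnorm] at h2
  have h3 : c = 0 := by linarith
  rw [hc, div_eq_zero_iff] at h3
  exact h3.resolve_right hv0.ne

theorem conformalCoeff_apply_zero (hx : IsSmoothImmersion k x)
    (hfree : HasFreeBoundaryInUnitBall k x) (e : Euc d) {q : M} {y : Euc k}
    (hy : y ∈ (extChartAt (𝓡∂ k) q).target) (hy0 : y 0 = 0) :
    conformalCoeff e (localParam k x q) y 0 = 0 := by
  set p := (extChartAt (𝓡∂ k) q).symm y with hpdef
  have hq : p ∈ (extChartAt (𝓡∂ k) q).source := (extChartAt (𝓡∂ k) q).map_target hy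
  have hp := mem_extChartAt_source (I := 𝓡∂ k) p
  have hpy : extChartAt (𝓡∂ k) q p = y := (extChartAt (𝓡∂ k) q).right_inv hy
  have hq0 : extChartAt (𝓡∂ k) q p 0 = 0 := by rw [hpy, hy0]
  have hb := mem_boundary_of_extChartAt_zero hq hq0
  have hp0 : extChartAt (𝓡∂ k) p p 0 = 0 := by
    have : extChartAt (𝓡∂ k) p p ∈ frontier (range (𝓡∂ k)) := hb
    rw [frontier_range_modelWithCornersEuclideanHalfSpace] at this
    exact Eq.symm this
  have h := tangentCoordChange_apply_zero hq hp0 hq0 (conformalVector_apply_zero hx hfree e hb)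
  rwa [← tangentCoordChange_conformalCoeff hx e hq, tangentCoordChange_inverse hq hp, hpy] at h

/-! ### Integration over the manifold -/

variable [CompactSpace M] [MeasurableSpace M] [BorelSpace M]

/-- The weak divergence formula for a cut-off function supported in a chart domain. -/
theorem integral_conformalVector_eq_zero (hx : IsSmoothImmersion k x) (hmin : IsMinimal k x)
    (hfree : HasFreeBoundaryInUnitBall k x) (e : Euc d) {ρ : M → ℝ}
    (hρ : ContMDiff (𝓡∂ k) 𝓘(ℝ, ℝ) ∞ ρ) {q : M}
    (hsupp : tsupport ρ ⊆ (extChartAt (𝓡∂ k) q).source) :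
    ∫ p, (chartDeriv ρ p p (conformalVector k e x p) + 2 * k * inner ℝ (x p) e * ρ p)
      ∂(areaMeasure k x) = 0 := by
  rw [integral_areaMeasure_eq hx (q := q) (continuous_divergence_conformalVector hx e hρ)]
  · have hTm := measurableSet_extChartAt_target (k := k) q
    -- The inverse chart has arbitrary values off its target, so the cut-off function is extended by
    -- zero; derivatives on the target are unaffected, as the target is relatively open in the
    -- half-space.
    have hind : ∀ y ∈ (extChartAt (𝓡∂ k) q).target,
        (extChartAt (𝓡∂ k) q).target.indicator (ρ ∘ (extChartAt (𝓡∂ k) q).symm)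
          =ᶠ[𝓝[range (𝓡∂ k)] y] ρ ∘ (extChartAt (𝓡∂ k) q).symm := fun y hy =>
      Filter.mem_of_superset (extChartAt_target_mem_nhdsWithin_of_mem hy)
        fun z hz => indicator_of_mem hz _
    have hcompact : IsCompact (extChartAt (𝓡∂ k) q '' tsupport ρ) :=
      (isClosed_tsupport ρ).isCompact.image_of_continuousOn
        ((continuousOn_extChartAt q).mono hsupp)
    have hsub : extChartAt (𝓡∂ k) q '' tsupport ρ ⊆ (extChartAt (𝓡∂ k) q).target := by
      rintro _ ⟨p, hp, rfl⟩
      exact (extChartAt (𝓡∂ k) q).map_source (hsupp hp)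
    rw [← setIntegral_conformalField_eq_zero (extChartAt_target_subset_range q)
      (fun y hy => contDiffWithinAt_comp_extChartAt_symm hx.smooth hy)
      (fun y hy => hx.fderivWithin_localParam_injective hy) (hmin q) e
      (fun y hy hy0 => conformalCoeff_apply_zero hx hfree e hy hy0) hcompact hsub
      (ρ := (extChartAt (𝓡∂ k) q).target.indicator (ρ ∘ (extChartAt (𝓡∂ k) q).symm))
      (fun y hy => (contDiffWithinAt_comp_extChartAt_symm hρ hy).congr_of_eventuallyEq
        (hind y hy) (indicator_of_mem hy _)) ?_]
    · refine setIntegral_congr_fun hTm fun y hy => ?_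
      rw [chartDeriv_conformalVector hx e hρ ((extChartAt (𝓡∂ k) q).map_target hy), chartDeriv,
        (extChartAt (𝓡∂ k) q).right_inv hy, (hind y hy).fderivWithin_eq (indicator_of_mem hy _),
        indicator_of_mem hy]
      rfl
    · intro y hy
      by_cases hyT : y ∈ (extChartAt (𝓡∂ k) q).target
      · rw [indicator_of_mem hyT, Function.comp_apply]
        refine image_eq_zero_of_notMem_tsupport fun h => hy ⟨_, h, ?_⟩
        exact (extChartAt (𝓡∂ k) q).right_inv hyT
      · exact indicator_of_notMem hyT _
  · intro p hp
    have hp' : p ∉ tsupport ρ := fun h => hp (hsupp h)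
    rw [chartDeriv_eq_zero_of_notMem_tsupport hp', image_eq_zero_of_notMem_tsupport hp']
    simp

/-- The weak formula is summed over a partition of unity subordinate to charts, finite by
compactness; the derivatives of its members add up to the derivative of `1`. -/
theorem integral_inner_eq_zero [T2Space M] (hx : IsSmoothImmersion k x) (hmin : IsMinimal k x)
    (hfree : HasFreeBoundaryInUnitBall k x) (e : Euc d) :
    ∫ p, inner ℝ (x p) e ∂(areaMeasure k x) = 0 := by
  have hfin := areaMeasure_finite hx
  obtain ⟨f, hf⟩ := SmoothPartitionOfUnity.exists_isSubordinate_chartAt_source (𝓡∂ k) M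
  have hS : {i | (Function.support (f i)).Nonempty}.Finite :=
    f.locallyFinite.finite_nonempty_of_compact
  set S := hS.toFinset with hSdef
  have hsum : ∀ p, ∑ i ∈ S, f i p = 1 := by
    intro p
    rw [← f.sum_eq_one (mem_univ p), finsum_eq_sum_of_support_subset]
    intro i hi
    rw [hSdef, Finite.coe_toFinset]
    exact ⟨p, hi⟩
  have hsmooth : ∀ i, ContMDiff (𝓡∂ k) 𝓘(ℝ, ℝ) ∞ (f i) := fun i => (f i).contMDiff
  have hderiv : ∀ p, ∑ i ∈ S, chartDeriv (k := k) (f i) p p = 0 := by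
    intro p
    have hy := mem_extChartAt_target (I := 𝓡∂ k) p
    have h := fderivWithin_fun_sum (u := S)
      (A := fun i => f i ∘ (extChartAt (𝓡∂ k) p).symm)
      ((𝓡∂ k).uniqueDiffOn _ (extChartAt_target_subset_range p hy)) fun i _ =>
      (contDiffWithinAt_comp_extChartAt_symm (hsmooth i) hy).differentiableWithinAt (by simp)
    simp only [Function.comp_apply, hsum] at h
    rw [fderivWithin_fun_const] at h
    exact h.symm
  have hint : ∀ i, Integrable (fun p => chartDeriv (f i) p p (conformalVector k e x p) +
      2 * k * inner ℝ (x p) e * f i p) (areaMeasure k x) := fun i =>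
    (continuous_divergence_conformalVector hx e (hsmooth i)).integrable_of_hasCompactSupport
      (HasCompactSupport.of_compactSpace _)
  have htotal : ∫ p, 2 * k * inner ℝ (x p) e ∂(areaMeasure k x) = 0 := by
    have h1 : ∀ p, 2 * k * inner ℝ (x p) e = ∑ i ∈ S,
        (chartDeriv (f i) p p (conformalVector k e x p) + 2 * k * inner ℝ (x p) e * f i p) := by
      intro p
      rw [Finset.sum_add_distrib, ← Finset.mul_sum, hsum, ← sum_apply, hderiv]
      simp
    rw [integral_congr_ae (Filter.Eventually.of_forall h1), integral_finsetSum _ fun i _ => hint i]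
    refine Finset.sum_eq_zero fun i _ =>
      integral_conformalVector_eq_zero hx hmin hfree e (hsmooth i) (q := i) ?_
    rw [extChartAt_source]
    exact hf i
  rw [integral_const_mul] at htotal
  have hk : (2 * k : ℝ) ≠ 0 := mul_ne_zero two_ne_zero (Nat.cast_ne_zero.2 (NeZero.ne k))
  exact (mul_eq_zero.1 htotal).resolve_left hk

end ConformalVector

end FreeBoundary

end

/-! ### The mass center -/

theorem mainTheorem4 {k n : ℕ} [NeZero k] {M : Type*} [TopologicalSpace M] [T2Space M]
    [CompactSpace M] [MeasurableSpace M] [BorelSpace M]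
    [ChartedSpace (EuclideanHalfSpace k) M] [IsManifold (𝓡∂ k) ∞ M]
    (x : M → Euc (n + 1))
    (hx : FreeBoundary.IsSmoothImmersion k x)
    (hmin : FreeBoundary.IsMinimal k x)
    (hfree : FreeBoundary.HasFreeBoundaryInUnitBall k x) :
    MeasureTheory.IsFiniteMeasure (FreeBoundary.areaMeasure k x) ∧
    MeasureTheory.Integrable x (FreeBoundary.areaMeasure k x) ∧
    ∫ p, x p ∂(FreeBoundary.areaMeasure k x) = 0 ∧
    FreeBoundary.massCenter k x = 0 := by
  have hfin := FreeBoundary.areaMeasure_finite hx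
  have hint : MeasureTheory.Integrable x (FreeBoundary.areaMeasure k x) :=
    hx.smooth.continuous.integrable_of_hasCompactSupport (HasCompactSupport.of_compactSpace x)
  have hzero : ∫ p, x p ∂(FreeBoundary.areaMeasure k x) = 0 := by
    refine ext_inner_left ℝ fun e => ?_
    rw [← integral_inner hint, inner_zero_right]
    simp only [real_inner_comm _ e]
    exact FreeBoundary.integral_inner_eq_zero hx hmin hfree e
  refine ⟨hfin, hint, hzero, ?_⟩
  -- This also covers empty `M`, where the inverse of the zero total area is `0` by convention.
  rw [FreeBoundary.massCenter, MeasureTheory.average_eq, hzero, smul_zero]
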